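/- Let $\mathcal X$ be a measurable space, $d_w\ge 1$, and let $\mathcal W\subseteq\mathbb R^{d_w}$ be measurable. Consider a binary model family $P_{ZW}=P_{Y|XW}P_XP_W$ with $Z=(X,Y)\in\mathcal X\times\{0,1\}$, where $P_X$ is a probability measure on $\mathcal X$ (not depending on $W$), $P_W$ is a prior probability measure on $\mathcal W$, and $P_{Y|XW}$ is a Markov kernel with conditional probabilities $p(y|x,w)$. Assume that $W\sim P_W$ has a Lebesgue density $p_W$ and finite differential entropy $h(W)=-\int p_W\log p_W$ (natural logarithm). Write $f_w(x)=\arg\max_y p(y|x,w)$. Assume that: 1. the family is realizable: $p(y|x,w)\in\{0,1\}$ for all $x\in\mathcal X$, $w\in\mathcal W$, $y\in\{0,1\}$; 2. the class of classifiers $\{f_w: w\in\mathcal W\}$ has finite VC dimension $d_{\mathrm{vc}}$; 3. the family is $\mu$-sensitive in expectation for some $0<\mu<\infty$: for every conditional distribution $P_{V|W}$ on $\mathcal W$ that is absolutely continuous with respect to Lebesgue measure, $$\mathbb E_{W,V}\big[P_X(\{x: f_W(x)\ne f_V(x)\})\big]\ \ge\ \mu\,\mathbb E_{W,V}\big[\|W-V\|_\infty\big],\qquad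 (W,V)\sim P_WP_{V|W}.$$ Given $W=w$, let $Z^n=(Z_1,\dots,Z_n)$ be i.i.d. from $P_{Z|W=w}=P_XP_{Y|X,W=w}$. A parametric learning rule is any Markov kernel $Q_{\widehat W|Z^n}$ from $(\mathcal X\times\{0,1\})^n$ to $\mathcal W$. Its 0-1 excess Bayes risk is $$E_n=\mathbb E\big[D(W\|\widehat W)\big],\qquad D(w\|v)=\mathbb E_{(X,Y)\sim P_{Z|W=w}}\big[\mathbb I[f_v(X)\ne Y]-\mathbb I[f_w(X)\ne Y]\big],$$ the expectation being over $W\sim P_W$, $Z^n\sim P_{Z^n|W}$ and $\widehat W\sim Q_{\widehat W|Z^n}$. Then for every $n\ge d_{\mathrm{vc}}$ and every parametric learning rule, $$E_n\ \ge\ \left(\frac{d_{\mathrm{vc}}}{e\,n}\right)^{d_{\mathrm{vc}}/d_w}\cdot\frac{\mu}{2e}\cdot\exp\!\big(h(W)/d_w\big).$$ In particular, if $d_w=d_{\mathrm{vc}}$, then $E_n\ge c\,d_{\mathrm{vc}}/n$ for all $n\ge d_{\mathrm{vc}}$ and all parametric learning rules, with the constant $c=\frac{\mu}{2e^2}\exp(h(W)/d_w)>0$;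 that is, $E_n=\Omega(d_{\mathrm{vc}}/n)$. -/

import Mathlib

open MeasureTheory ProbabilityTheory Asymptotics

noncomputable section

/-- A binary parametric Bayesian model family `P_{ZW} = P_{Y|XW} P_X P_W` with labels in
`Bool = {0, 1}`: a parameter set `params ⊆ ℝ^dw`, a law `P_X` of the inputs that does not depend
on the parameter, a prior `P_W` on `params`, and a conditional law `P_{Y|XW}` of the label. -/
structure ModelFamily (𝒳 : Type*) [MeasurableSpace 𝒳] (dw : ℕ) where
  /-- the set of admissible parameters -/
  params : Set (Fin dw → ℝ)
  measurableSet_params : MeasurableSet params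
  /-- `P_X` -/
  inputLaw : Measure 𝒳
  isProbabilityMeasure_inputLaw : IsProbabilityMeasure inputLaw
  /-- `P_W` -/
  prior : Measure params
  isProbabilityMeasure_prior : IsProbabilityMeasure prior
  /-- `P_{Y|XW}` -/
  labelKernel : Kernel (params × 𝒳) Bool
  isMarkovKernel_labelKernel : IsMarkovKernel labelKernel

attribute [instance] ModelFamily.isProbabilityMeasure_inputLaw
  ModelFamily.isProbabilityMeasure_prior ModelFamily.isMarkovKernel_labelKernel

/-- The `n`-fold product of a Markov kernel with itself: given `a`, draw `n` independent samples
from `κ a`. -/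
def iidKernel {α β : Type*} [MeasurableSpace α] [MeasurableSpace β] (n : ℕ) (κ : Kernel α β)
    [IsMarkovKernel κ] : Kernel α (Fin n → β) where
  toFun a := Measure.pi fun _ : Fin n => κ a
  measurable' := by
    refine Measurable.measure_of_isPiSystem_of_isProbabilityMeasure
      generateFrom_pi.symm isPiSystem_pi ?_
    rintro _ ⟨s, hs, rfl⟩
    simp only [Measure.pi_pi]
    exact Finset.measurable_fun_prod _ fun i _ => κ.measurable_coe (hs i (Set.mem_univ i))

/-- The density of a measure on `ℝ^k` with respect to Lebesgue measure. -/
def lebesgueDensity {k : ℕ} (ν : Measure (Fin k → ℝ)) (x : Fin k → ℝ) : ℝ :=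
  (ν.rnDeriv volume x).toReal

/-- `ν` has a Lebesgue density `p`, and the differential entropy integral `-∫ p log p` converges
absolutely. -/
def HasDiffEntropy {k : ℕ} (ν : Measure (Fin k → ℝ)) : Prop :=
  ν ≪ volume ∧ Integrable (fun x => Real.negMulLog (lebesgueDensity ν x)) volume

/-- The differential entropy `-∫ p log p` (natural logarithm) of a measure with density `p`. -/
def diffEntropy {k : ℕ} (ν : Measure (Fin k → ℝ)) : ℝ :=
  ∫ x, Real.negMulLog (lebesgueDensity ν x)

namespace ModelFamily

variable {𝒳 : Type*} [MeasurableSpace 𝒳] {dw : ℕ} (M : ModelFamily 𝒳 dw)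

/-- The conditional label probability `p(y | x, w)`. -/
def labelProb (y : Bool) (x : 𝒳) (w : M.params) : ℝ :=
  (M.labelKernel (w, x)).real {y}

/-- `P_{Z|W}` with `Z = (X, Y)`: draw `X` from `P_X`, then `Y` from `P_{Y|X,W}`. -/
def sampleKernel : Kernel M.params (𝒳 × Bool) :=
  Kernel.const M.params M.inputLaw ⊗ₖ M.labelKernel

instance : IsMarkovKernel M.sampleKernel := by
  unfold sampleKernel
  infer_instance

/-- `P_{Z^n|W}`: the training set consists of `n` samples that are i.i.d. given `W`. -/
def trainKernel (n : ℕ) : Kernel M.params (Fin n → 𝒳 × Bool) :=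
  iidKernel n M.sampleKernel

/-- Realizability: the label is a deterministic function of the input and the parameter. -/
def Realizable : Prop :=
  ∀ (y : Bool) (x : 𝒳) (w : M.params), M.labelProb y x w = 0 ∨ M.labelProb y x w = 1

open Classical in
/-- The classification rule `argmax_y p(y | x, w)`. A tie, which a realizable model does not have,
is resolved as `false`. -/
def classify (w : M.params) (x : 𝒳) : Bool :=
  decide (M.labelProb false x w < M.labelProb true x w)

/-- The points of `S` can be labelled in all possible ways by the classifiers of the family. -/
def Shatters (S : Finset 𝒳) : Prop :=
  ∀ g : 𝒳 → Bool, ∃ w : M.params, ∀ x ∈ S, M.classify w x = g x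

/-- The class of classifiers `classify w` has (finite) VC dimension `k`: the largest cardinality of
a shattered set of points is `k`. -/
def HasVCDim (k : ℕ) : Prop :=
  IsGreatest {m : ℕ | ∃ S : Finset 𝒳, S.card = m ∧ M.Shatters S} k

/-- The discrepancy set: the inputs that `w` and `v` classify differently. -/
def discrepancySet (w v : M.params) : Set 𝒳 :=
  {x | M.classify w x ≠ M.classify v x}

/-- `μ`-sensitivity in expectation: `E[P_X(E(W,V))] ≥ μ E‖W - V‖_∞` for every absolutely
continuous conditional law `P_{V|W}` on the parameter set. The norm of `Fin dw → ℝ` is the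
sup norm. -/
def SensitiveInExpectation (μ : ℝ) : Prop :=
  0 < μ ∧ ∀ κ : Kernel M.params M.params, IsMarkovKernel κ →
    (∀ w, (κ w).map (Subtype.val : M.params → Fin dw → ℝ) ≪ volume) →
    ENNReal.ofReal μ *
        ∫⁻ w, ∫⁻ v, ENNReal.ofReal ‖(w : Fin dw → ℝ) - (v : Fin dw → ℝ)‖ ∂(κ w) ∂M.prior
      ≤ ∫⁻ w, ∫⁻ v, M.inputLaw (M.discrepancySet w v) ∂(κ w) ∂M.prior

open Classical in
/-- The 0-1 loss of the parameter `v` at the test sample `z = (x, y)`. -/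
def zeroOneLoss (z : 𝒳 × Bool) (v : M.params) : ℝ :=
  if M.classify v z.1 ≠ z.2 then 1 else 0

/-- The excess loss `D(w ‖ v)` for the 0-1 loss. -/
def excessLoss (w v : M.params) : ℝ :=
  ∫ z, (M.zeroOneLoss z v - M.zeroOneLoss z w) ∂(M.sampleKernel w)

/-- The 0-1 excess Bayes risk `E_n = E[D(W ‖ Ŵ)]` of the learning rule `Q = Q_{Ŵ|Z^n}`, where
`W ∼ P_W`, `Z^n ∼ P_{Z^n|W}` and `Ŵ ∼ Q_{Ŵ|Z^n}`. -/
def excessBayesRisk {n : ℕ} (Q : Kernel (Fin n → 𝒳 × Bool) M.params) : ℝ :=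
  ∫ w, ∫ z, ∫ v, M.excessLoss w v ∂(Q z) ∂(M.trainKernel n w) ∂M.prior

/-- The law of the random parameter vector `W`, as a measure on `ℝ^dw`. -/
def paramLaw : Measure (Fin dw → ℝ) :=
  M.prior.map (Subtype.val : M.params → Fin dw → ℝ)

end ModelFamily

end

/-! Under realizability the excess loss is the pseudometric `D(w, v) = P_X(f_w ≠ f_v)`. If `D`
dominates `μ‖w - v‖`, a rule with small risk locates `W` well. But a fixed input sample admits at
most `G = ∑_{k ≤ d} C(n, k)` labellings, and a variable of entropy `h(W)` cannot be located
precisely from so few messages.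

Quantitatively (`exp_diffEntropy_sub_le`), Jensen bounds `exp(h(W) - E_n/(μ s))` by the mean of
`exp(-log p_W(W) - D(W, Ŵ)/(μ s))`. Summing over all achievable labellings instead of the actual one
decouples `W` from `Ŵ` at cost `G`. For a fixed output `v`, the factor `1/p_W` cancels the prior and
leaves a Lebesgue integral of `exp(-‖w - c‖/s)`, at most `(2 d_w s)^{d_w}`. Optimizing `s` and using
`G ≤ (en/d)^d` gives the bound.

The delicate point is that sensitivity is assumed only on average.
`ae_ae_le_of_lintegral_density_le` tests it with a conditional law concentrated on violating pairs.
Parameters without violations draw `v` from a cell of nearly equal classifiers, which adds almost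
nothing to the right side. So sensitivity holds for almost all pairs under the prior. A rule may
still output values in a null set; `exists_center` therefore replaces any `v` by a point `c`, common
to the boxes of radius `D(w, v)/μ` about almost all `w`. -/

section

open scoped ENNReal symmDiff

/-! ### Approximation by sets with countably many sections. -/

section SectionApproximation

variable {W X : Type*} [MeasurableSpace W] [MeasurableSpace X]

/-- The sets whose sections are `F (g w)` for a measurable `g` with values in `ℕ`. -/
def countableSectionSets (W X : Type*) [MeasurableSpace W] [MeasurableSpace X] :
    Set (Set (W × X)) :=
  {s | ∃ g : W → ℕ, Measurable g ∧ ∃ F : ℕ → Set X, (∀ k, MeasurableSet (F k)) ∧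
    s = {p | p.2 ∈ F (g p.1)}}

lemma measurableSet_of_mem_countableSectionSets {s : Set (W × X)}
    (hs : s ∈ countableSectionSets W X) : MeasurableSet s := by
  obtain ⟨g, hg, F, hF, rfl⟩ := hs
  have : {p : W × X | p.2 ∈ F (g p.1)} = ⋃ k, (g ⁻¹' {k}) ×ˢ F k := by
    ext p; simp
  rw [this]
  exact .iUnion fun k => (hg (measurableSet_singleton k)).prod (hF k)

lemma isSetAlgebra_countableSectionSets : IsSetAlgebra (countableSectionSets W X) where
  empty_mem := ⟨fun _ => 0, measurable_const, fun _ => ∅, fun _ => .empty, by simp⟩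
  compl_mem := by
    rintro _ ⟨g, hg, F, hF, rfl⟩
    exact ⟨g, hg, fun k => (F k)ᶜ, fun k => (hF k).compl, by ext; simp⟩
  union_mem := by
    rintro _ _ ⟨g, hg, F, hF, rfl⟩ ⟨g', hg', F', hF', rfl⟩
    -- The common refinement of two countable partitions, indexed by pairs.
    refine ⟨fun w => Nat.pair (g w) (g' w), ?_,
      fun k => F k.unpair.1 ∪ F' k.unpair.2, fun k => (hF _).union (hF' _), ?_⟩
    · exact (measurable_of_countable (fun p : ℕ × ℕ => Nat.pair p.1 p.2)).comp (hg.prodMk hg')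
    · ext; simp

/-- A measurable rectangle `a ×ˢ b` has only the sections `b` and `∅`, so the algebra already
contains a generating family. -/
lemma generateFrom_countableSectionSets :
    (inferInstance : MeasurableSpace (W × X)) =
      MeasurableSpace.generateFrom (countableSectionSets W X) := by
  refine le_antisymm ?_ (MeasurableSpace.generateFrom_le fun s hs =>
    measurableSet_of_mem_countableSectionSets hs)
  classical
  rw [← generateFrom_prod]
  refine MeasurableSpace.generateFrom_mono ?_
  rintro _ ⟨a, ha, b, hb, rfl⟩
  refine ⟨fun w => if w ∈ a then 1 else 0, Measurable.ite ha measurable_const measurable_const,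
    fun k => if k = 1 then b else ∅, fun k => ?_, ?_⟩
  · change MeasurableSet (if k = 1 then b else ∅)
    split_ifs
    exacts [hb, .empty]
  · ext ⟨w, x⟩
    by_cases h : w ∈ a <;> simp [h]

/-- A measurable subset of a product can be approximated in measure by a set with countably many
different sections. -/
lemma exists_countable_section_approx (P : Measure W) [IsFiniteMeasure P] (ν : Measure X)
    [IsFiniteMeasure ν] {E : Set (W × X)} (hE : MeasurableSet E) {ε : ℝ≥0∞} (hε : 0 < ε) :
    ∃ g : W → ℕ, Measurable g ∧ ∃ F : ℕ → Set X, (∀ k, MeasurableSet (F k)) ∧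
      Measurable (fun w => ν (F (g w) ∆ (Prod.mk w ⁻¹' E))) ∧
      ∫⁻ w, ν (F (g w) ∆ (Prod.mk w ⁻¹' E)) ∂P ≤ ε := by
  obtain ⟨t, ht, hlt⟩ := exists_measure_symmDiff_lt_of_generateFrom_isSetRing (μ := P.prod ν)
    isSetAlgebra_countableSectionSets.isSetRing
    ⟨{Set.univ}, Set.countable_singleton _,
      Set.singleton_subset_iff.2 isSetAlgebra_countableSectionSets.univ_mem, by simp⟩
    generateFrom_countableSectionSets hE hε
  have htm := measurableSet_of_mem_countableSectionSets ht
  obtain ⟨g, hg, F, hF, rfl⟩ := ht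
  refine ⟨g, hg, F, hF, measurable_measure_prodMk_left (htm.symmDiff hE), ?_⟩
  rw [Measure.prod_apply (htm.symmDiff hE)] at hlt
  exact hlt.le

end SectionApproximation

/-! ### From averaged to almost-everywhere sensitivity. -/

/-- If `N ≤ d` holds on average for all conditional laws of `v` given `w` with a density, and the
space splits into countably many cells on which `d` is small on average, then `N ≤ d` holds almost
everywhere. -/
lemma ae_ae_le_of_lintegral_density_le {W : Type*} [MeasurableSpace W] (P : Measure W)
    [IsProbabilityMeasure P] {d N : W → W → ℝ≥0∞} (hd : Measurable (Function.uncurry d))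
    (hN : Measurable (Function.uncurry N)) (hd1 : ∀ w v, d w v ≤ 1)
    (h : ∀ k : W → W → ℝ≥0∞, Measurable (Function.uncurry k) → (∀ w, ∫⁻ v, k w v ∂P = 1) →
      ∫⁻ w, ∫⁻ v, k w v * N w v ∂P ∂P ≤ ∫⁻ w, ∫⁻ v, k w v * d w v ∂P ∂P)
    (happrox : ∀ ε : ℝ≥0∞, 0 < ε → ∃ g : W → ℕ, Measurable g ∧ ∃ e : W → ℝ≥0∞, Measurable e ∧
      ∫⁻ w, e w ∂P ≤ ε ∧ ∀ w v, g w = g v → d w v ≤ e w + e v) :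
    ∀ᵐ w ∂P, ∀ᵐ v ∂P, N w v ≤ d w v := by
  classical
  set A : Set (W × W) := {p | d p.1 p.2 < N p.1 p.2} with hA
  have hAm : MeasurableSet A := measurableSet_lt hd hN
  have hAsec : ∀ w, MeasurableSet {v | d w v < N w v} := fun w => measurable_prodMk_left hAm
  set a : W → ℝ≥0∞ := fun w => P {v | d w v < N w v} with ha
  have ham : Measurable a := measurable_measure_prodMk_left hAm
  have ha1 : ∀ w, a w ≤ 1 := fun w => prob_le_one
  suffices hB : P {w | a w ≠ 0} = 0 by
    have hB' : ∀ᵐ w ∂P, a w = 0 := by rw [ae_iff]; exact hB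
    filter_upwards [hB'] with w hw
    rw [ae_iff]
    simpa [ha] using hw
  by_contra hB
  have hBm : MeasurableSet {w | a w ≠ 0} := (ham (measurableSet_singleton 0)).compl
  -- Where `a w ≠ 0`, `f u w` is the mean of `u w` under `P` conditioned on the violating `v`.
  set f : (W → W → ℝ≥0∞) → W → ℝ≥0∞ := fun u w => (a w)⁻¹ * ∫⁻ v in {v | d w v < N w v}, u w v ∂P
    with hf
  have hfm : ∀ u : W → W → ℝ≥0∞, Measurable (Function.uncurry u) → Measurable (f u) := by
    intro u hu
    refine ham.inv.mul ?_
    have : (fun w => ∫⁻ v in {v | d w v < N w v}, u w v ∂P) =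
        fun w => ∫⁻ v, A.indicator (Function.uncurry u) (w, v) ∂P := by
      ext w
      rw [← lintegral_indicator (hAsec w)]
      rfl
    rw [this]
    exact (hu.indicator hAm).lintegral_prod_right'
  have hlt : ∫⁻ w in {w | a w ≠ 0}, f d w ∂P < ∫⁻ w in {w | a w ≠ 0}, f N w ∂P := by
    refine setLIntegral_strict_mono hBm hB (hfm N hN) ?_ (ae_of_all _ fun w hw => ?_)
    · refine ne_top_of_le_ne_top ENNReal.one_ne_top
        ((setLIntegral_mono' hBm (g := fun _ => 1) fun w hw => ?_).trans ?_)
      · calc f d w ≤ (a w)⁻¹ * ∫⁻ v in {v | d w v < N w v}, 1 ∂P := by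
              simp only [hf]; gcongr; exact hd1 _ _
          _ ≤ 1 := by
              rw [setLIntegral_one]
              exact ENNReal.inv_mul_le_one _
      · simp only [setLIntegral_one]; exact prob_le_one
    · have hfin : (a w) ≠ ∞ := ((ha1 w).trans_lt ENNReal.one_lt_top).ne
      refine (ENNReal.mul_lt_mul_iff_right (ENNReal.inv_ne_zero.2 hfin)
        (ENNReal.inv_ne_top.2 hw)).2 ?_
      refine setLIntegral_strict_mono (hAsec w) hw hN.of_uncurry_left ?_
        (ae_of_all _ fun v hv => hv)
      refine ne_top_of_le_ne_top ENNReal.one_ne_top ?_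
      calc ∫⁻ v in {v | d w v < N w v}, d w v ∂P ≤ ∫⁻ v in {v | d w v < N w v}, 1 ∂P :=
            lintegral_mono fun v => hd1 _ _
        _ ≤ 1 := by rw [setLIntegral_one]; exact prob_le_one
  -- The reverse of `hlt` is now proved up to an arbitrary `ε`.
  refine hlt.not_ge (ENNReal.le_of_forall_pos_le_add fun ε hε _ => ?_)
  obtain ⟨g, hg, e, he, heε, hde⟩ := happrox (ε / 2)
    (ENNReal.div_pos (by simpa using hε.ne') (by simp))
  set C : Set (W × W) := {p | g p.2 = g p.1} with hC
  have hCm : MeasurableSet C :=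
    measurableSet_eq_fun (hg.comp measurable_snd) (hg.comp measurable_fst)
  have hCsec : ∀ w, MeasurableSet {v | g v = g w} := fun w => measurable_prodMk_left hCm
  set c : W → ℝ≥0∞ := fun w => P {v | g v = g w} with hc
  have hcm : Measurable c := measurable_measure_prodMk_left hCm
  have hcfin : ∀ w, c w ≠ ∞ := fun w => measure_ne_top _ _
  have hafin : ∀ w, a w ≠ ∞ := fun w => measure_ne_top _ _
  -- There are countably many cells, so the null ones have null union.
  have hcpos : ∀ᵐ w ∂P, c w ≠ 0 := by
    have : {w | ¬ c w ≠ 0} ⊆ ⋃ j : {j : ℕ // P (g ⁻¹' {j}) = 0}, g ⁻¹' {j.1} := by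
      intro w hw
      simp only [Set.mem_iUnion]
      exact ⟨⟨g w, not_not.1 hw⟩, rfl⟩
    rw [ae_iff]
    exact measure_mono_null this (measure_iUnion_null fun j => j.2)
  -- Violating `w` draw a violating `v`; other `w` draw `v` from their own cell, where `d` is small.
  -- The value `1` on null cells only keeps the total mass equal to one for every `w`.
  set k : W → W → ℝ≥0∞ := fun w v =>
    if a w ≠ 0 then (a w)⁻¹ * A.indicator 1 (w, v)
    else if c w ≠ 0 then (c w)⁻¹ * C.indicator 1 (w, v) else 1 with hk
  have hkm : Measurable (Function.uncurry k) := by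
    refine Measurable.ite (measurable_fst hBm) ?_
      (Measurable.ite (measurable_fst (hcm (measurableSet_singleton 0)).compl) ?_ measurable_const)
    · exact (ham.comp measurable_fst).inv.mul (measurable_one.indicator hAm)
    · exact (hcm.comp measurable_fst).inv.mul (measurable_one.indicator hCm)
  have hAind : ∀ u : W → W → ℝ≥0∞, Measurable (Function.uncurry u) → ∀ w,
      ∫⁻ v, (a w)⁻¹ * A.indicator 1 (w, v) * u w v ∂P = f u w := by
    intro u hu w
    have h1 : Measurable fun v => A.indicator (1 : W × W → ℝ≥0∞) (w, v) :=
      (measurable_one.indicator hAm).comp measurable_prodMk_left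
    simp only [hf, mul_assoc]
    rw [lintegral_const_mul _ (show Measurable fun v => A.indicator 1 (w, v) * u w v from
      h1.mul hu.of_uncurry_left), ← lintegral_indicator (hAsec w)]
    congr 2
    ext v
    by_cases hv : (w, v) ∈ A
    · rw [Set.indicator_of_mem hv, Set.indicator_of_mem (show v ∈ {v | d w v < N w v} from hv)]
      simp
    · rw [Set.indicator_of_notMem hv,
        Set.indicator_of_notMem (show v ∉ {v | d w v < N w v} from hv)]
      simp
  have hCind1 : ∀ w, ∫⁻ v, C.indicator 1 (w, v) ∂P = c w := by
    intro w
    simp only [hc]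
    rw [← lintegral_indicator_one (hCsec w)]
    rfl
  have hAind1 : ∀ w, ∫⁻ v, A.indicator 1 (w, v) ∂P = a w := by
    intro w
    simp only [ha]
    rw [← lintegral_indicator_one (hAsec w)]
    rfl
  have hCm' : ∀ w, Measurable fun v => C.indicator (1 : W × W → ℝ≥0∞) (w, v) := fun w =>
    (measurable_one.indicator hCm).comp measurable_prodMk_left
  have hAm' : ∀ w, Measurable fun v => A.indicator (1 : W × W → ℝ≥0∞) (w, v) := fun w =>
    (measurable_one.indicator hAm).comp measurable_prodMk_left
  have hk1 : ∀ w, ∫⁻ v, k w v ∂P = 1 := by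
    intro w
    simp only [hk]
    by_cases h1 : a w = 0
    · by_cases h2 : c w = 0
      · simp [h1, h2]
      · simp only [h1, h2, ne_eq, not_true_eq_false, not_false_eq_true, if_true, if_false]
        rw [lintegral_const_mul _ (hCm' w), hCind1, ENNReal.inv_mul_cancel h2 (hcfin w)]
    · simp only [h1, ne_eq, not_false_eq_true, if_true]
      rw [lintegral_const_mul _ (hAm' w), hAind1, ENNReal.inv_mul_cancel h1 (hafin w)]
  -- The mean of `e` over the cell of `w`. Averaging this over `w` gives at most the integral of
  -- `e`, because being in the same cell is symmetric and `c` is constant on cells.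
  set G : W → ℝ≥0∞ := fun w => (c w)⁻¹ * ∫⁻ v, C.indicator 1 (w, v) * e v ∂P with hG
  have hGint : ∫⁻ w, G w ∂P ≤ ε / 2 := by
    calc ∫⁻ w, G w ∂P
        = ∫⁻ w, ∫⁻ v, (c w)⁻¹ * (C.indicator 1 (w, v) * e v) ∂P ∂P := by
          refine lintegral_congr fun w => ?_
          rw [lintegral_const_mul _ (show Measurable fun v => C.indicator 1 (w, v) * e v from
            (hCm' w).mul he)]
      _ = ∫⁻ v, ∫⁻ w, (c w)⁻¹ * (C.indicator 1 (w, v) * e v) ∂P ∂P := by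
          refine lintegral_lintegral_swap (Measurable.aemeasurable ?_)
          exact (hcm.comp measurable_fst).inv.mul
            ((measurable_one.indicator hCm).mul (he.comp measurable_snd))
      _ = ∫⁻ v, ∫⁻ w, (c v)⁻¹ * e v * C.indicator 1 (v, w) ∂P ∂P := by
          refine lintegral_congr fun v => lintegral_congr fun w => ?_
          by_cases hvw : g v = g w
          · have h1 : (w, v) ∈ C := hvw
            have h2 : (v, w) ∈ C := hvw.symm
            have h3 : c w = c v := by simp only [hc, hvw]
            rw [Set.indicator_of_mem h1, Set.indicator_of_mem h2, h3]
            simp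
          · have h1 : (w, v) ∉ C := hvw
            have h2 : (v, w) ∉ C := fun h => hvw h.symm
            rw [Set.indicator_of_notMem h1, Set.indicator_of_notMem h2]
            simp
      _ ≤ ∫⁻ v, e v ∂P := by
          refine lintegral_mono fun v => ?_
          rw [lintegral_const_mul _ (hCm' v), hCind1, mul_right_comm]
          exact mul_le_of_le_one_left' (ENNReal.inv_mul_le_one _)
      _ ≤ ε / 2 := heε
  calc ∫⁻ w in {w | a w ≠ 0}, f N w ∂P
      ≤ ∫⁻ w, ∫⁻ v, k w v * N w v ∂P ∂P := by
        rw [← lintegral_indicator hBm]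
        refine lintegral_mono fun w => ?_
        refine Set.indicator_le' (s := {w | a w ≠ 0}) (f := f N)
          (g := fun w => ∫⁻ v, k w v * N w v ∂P) (fun w hw => ?_) (fun _ _ => zero_le) w
        have hw' : a w ≠ 0 := hw
        rw [← hAind N hN w]
        simp only [hk, hw', ne_eq, not_false_eq_true, if_true, le_refl]
    _ ≤ ∫⁻ w, ∫⁻ v, k w v * d w v ∂P ∂P := h k hkm hk1
    _ ≤ ∫⁻ w, ({w | a w ≠ 0}.indicator (f d) w + (e w + G w)) ∂P := by
        refine lintegral_mono_ae ?_
        filter_upwards [hcpos] with w hcw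
        by_cases h1 : a w = 0
        · have h2 : w ∉ {w | a w ≠ 0} := by simpa using h1
          rw [Set.indicator_of_notMem h2, zero_add]
          calc ∫⁻ v, k w v * d w v ∂P
              ≤ ∫⁻ v, (c w)⁻¹ * (C.indicator 1 (w, v) * (e w + e v)) ∂P := by
                refine lintegral_mono fun v => ?_
                simp only [hk, h1, hcw, ne_eq, not_true_eq_false, not_false_eq_true, if_true,
                  if_false, mul_assoc]
                refine mul_le_mul_right ?_ _
                by_cases hv : (w, v) ∈ C
                · refine mul_le_mul_right ?_ _
                  exact hde w v (show g v = g w from hv).symm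
                · simp [Set.indicator_of_notMem hv]
            _ = (c w)⁻¹ * (c w * e w) + G w := by
                rw [lintegral_const_mul _ (show Measurable fun v => C.indicator 1 (w, v) * (e w + e v) from
                  (hCm' w).mul (he.const_add _))]
                simp only [mul_add]
                rw [lintegral_add_left ((hCm' w).mul_const _), lintegral_mul_const _ (hCm' w),
                  hCind1, mul_add]
            _ ≤ e w + G w := by
                rw [← mul_assoc, ENNReal.inv_mul_cancel hcw (hcfin w), one_mul]
        · have h2 : w ∈ {w | a w ≠ 0} := h1
          rw [Set.indicator_of_mem h2, ← hAind d hd w]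
          simp only [hk, h1, ne_eq, not_false_eq_true, if_true]
          exact le_self_add
    _ = ∫⁻ w in {w | a w ≠ 0}, f d w ∂P + (∫⁻ w, e w ∂P + ∫⁻ w, G w ∂P) := by
        rw [lintegral_add_left ((hfm d hd).indicator hBm), lintegral_add_left he,
          lintegral_indicator hBm]
    _ ≤ ∫⁻ w in {w | a w ≠ 0}, f d w ∂P + (ε / 2 + ε / 2) := by gcongr
    _ = ∫⁻ w in {w | a w ≠ 0}, f d w ∂P + ε := by rw [ENNReal.add_halves]

/-! ### Helly's theorem for boxes, modulo null sets. -/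

/-- Boxes that meet pairwise have a common point, up to null sets: if almost all pairs `w, w'`
satisfy `|x w i - x w' i| ≤ r w + r w'`, then a single centre `c` satisfies `|x w i - c i| ≤ r w`
for almost all `w`. -/
lemma exists_ae_abs_sub_le_of_ae_ae_abs_sub_le {W ι : Type*} [MeasurableSpace W] [Finite ι]
    (P : Measure W) [NeZero P] {x : W → ι → ℝ} {r : W → ℝ} {R : ℝ} (hR : ∀ w, r w ≤ R)
    (h : ∀ᵐ w ∂P, ∀ᵐ w' ∂P, ∀ i, |x w i - x w' i| ≤ r w + r w') :
    ∃ c : ι → ℝ, ∀ᵐ w ∂P, ∀ i, |x w i - c i| ≤ r w := by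
  -- In each coordinate, the largest left endpoint of pairwise meeting intervals lies in all of
  -- them. The bound `R` serves only to keep the left endpoints bounded below.
  refine ⟨fun i => essSup (fun w => x w i - r w) P, ?_⟩
  obtain ⟨w₀, hw₀⟩ := h.exists
  rw [ae_all_iff]
  intro i
  have hbdd : Filter.IsBoundedUnder (· ≤ ·) (ae P) fun w => x w i - r w := by
    refine Filter.isBoundedUnder_of_eventually_le (a := x w₀ i + r w₀) ?_
    filter_upwards [hw₀] with w hw
    linarith [(abs_le.1 (hw i)).1]
  have hcobdd : Filter.IsCoboundedUnder (· ≤ ·) (ae P) fun w => x w i - r w := by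
    refine Filter.IsBoundedUnder.isCoboundedUnder_le
      (Filter.isBoundedUnder_of_eventually_ge (a := x w₀ i - r w₀ - 2 * R) ?_)
    filter_upwards [hw₀] with w hw
    linarith [(abs_le.1 (hw i)).2, hR w]
  filter_upwards [h, ae_le_essSup hbdd] with w hw hle
  rw [abs_le]
  constructor
  · have : essSup (fun w => x w i - r w) P ≤ x w i + r w := by
      refine essSup_le_of_ae_le _ ?_ hcobdd
      filter_upwards [hw] with w' hw'
      linarith [(abs_le.1 (hw' i)).1]
    linarith
  · linarith

/-! ### Laplace integrals. -/

/-- The normalizing constant of the Laplace distribution. -/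
lemma integral_exp_neg_abs_div {b : ℝ} (hb : 0 < b) : ∫ x : ℝ, Real.exp (-|x| / b) = 2 * b := by
  rw [integral_comp_abs (f := fun x => Real.exp (-x / b))]
  have h := integral_exp_mul_Ioi (a := -1 / b) (div_neg_of_neg_of_pos (by norm_num) hb) 0
  have h2 : (fun x : ℝ => Real.exp (-x / b)) = fun x => Real.exp (-1 / b * x) := by
    ext x
    congr 1
    ring
  rw [h2, h, mul_zero, Real.exp_zero]
  field_simp

/-- The integral of `exp (-‖x - c‖ / s)` for the sup norm on `ℝ^k`. -/
lemma lintegral_exp_neg_norm_sub_le {k : ℕ} (hk : 0 < k) {s : ℝ} (hs : 0 < s) (c : Fin k → ℝ) :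
    ∫⁻ x : Fin k → ℝ, ENNReal.ofReal (Real.exp (-‖x - c‖ / s)) ≤
      ENNReal.ofReal ((2 * (k * s)) ^ k) := by
  have hb : 0 < k * s := by positivity
  have hint : Integrable fun x : ℝ => Real.exp (-|x| / (k * s)) := by
    by_contra hn
    have := integral_exp_neg_abs_div hb
    rw [integral_undef hn] at this
    linarith
  have hprod : Integrable fun x : Fin k → ℝ => ∏ i, Real.exp (-|x i| / (k * s)) :=
    Integrable.fintype_prod fun _ => hint
  rw [lintegral_sub_right_eq_self (fun x : Fin k → ℝ => ENNReal.ofReal (Real.exp (-‖x‖ / s))) c]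
  -- Since `∑ |x i| ≤ k‖x‖`, a product of one-dimensional Laplace profiles of scale `k * s`
  -- dominates; this is the source of the factor `k`.
  calc ∫⁻ x : Fin k → ℝ, ENNReal.ofReal (Real.exp (-‖x‖ / s))
      ≤ ∫⁻ x : Fin k → ℝ, ENNReal.ofReal (∏ i, Real.exp (-|x i| / (k * s))) := by
        refine lintegral_mono fun x => ENNReal.ofReal_le_ofReal ?_
        rw [← Real.exp_sum]
        refine Real.exp_le_exp.2 ?_
        rw [← Finset.sum_div, Finset.sum_neg_distrib, neg_div, neg_div, neg_le_neg_iff,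
          div_le_div_iff₀ hb hs]
        have : ∑ i, |x i| ≤ k * ‖x‖ := by
          calc ∑ i, |x i| ≤ ∑ _i : Fin k, ‖x‖ :=
                Finset.sum_le_sum fun i _ => norm_le_pi_norm x i
            _ = k * ‖x‖ := by simp
        nlinarith
    _ = ENNReal.ofReal ((2 * (k * s)) ^ k) := by
        rw [← ofReal_integral_eq_lintegral_ofReal hprod
          (ae_of_all _ fun x => Finset.prod_nonneg fun i _ => (Real.exp_pos _).le),
          integral_fintype_prod_volume_eq_pow fun x : ℝ => Real.exp (-|x| / (k * s)),
          integral_exp_neg_abs_div hb, Fintype.card_fin]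

/-! ### Sauer–Shelah counting. -/

/-- A sample of size `n` is labelled by a class of VC dimension at most `d` in at most
`∑ k ≤ d, n.choose k` ways. -/
lemma card_le_sum_choose_of_shattered_card_le {W X : Type*} {f : W → X → Bool} {d n : ℕ}
    (hd : ∀ S : Finset X, (∀ g : X → Bool, ∃ w, ∀ x ∈ S, f w x = g x) → S.card ≤ d)
    (x : Fin n → X) (T : Finset (Fin n → Bool)) (hT : ∀ y ∈ T, ∃ w, ∀ i, f w (x i) = y i) :
    T.card ≤ ∑ k ∈ Finset.Iic d, n.choose k := by
  classical
  set φ : (Fin n → Bool) → Finset (Fin n) := fun y => Finset.univ.filter fun i => y i = true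
    with hφ
  have hφinj : Function.Injective φ := by
    intro y y' h
    ext i
    have := congrArg (i ∈ ·) h
    simpa [hφ] using this
  rw [← Finset.card_image_of_injective T hφinj]
  refine (Finset.card_le_card_shatterer _).trans
    (Finset.card_shatterer_le_sum_vcDim.trans ?_)
  rw [Fintype.card_fin]
  refine Finset.sum_le_sum_of_subset (Finset.Iic_subset_Iic.2 (Finset.sup_le fun S hS => ?_))
  rw [Finset.mem_shatterer] at hS
  have key : ∀ U ⊆ S, ∃ w, ∀ i ∈ S, f w (x i) = decide (i ∈ U) := by
    intro U hU
    obtain ⟨u, hu, hSu⟩ := hS hU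
    obtain ⟨y, hy, rfl⟩ := Finset.mem_image.1 hu
    obtain ⟨w, hw⟩ := hT y hy
    refine ⟨w, fun i hi => ?_⟩
    rw [hw, ← hSu]
    simp [hφ, hi]
  -- A repeated sample point always receives equal labels, so a shattered index set cannot contain
  -- it twice; its image is a shattered set of points of the same size.
  have hinj : Set.InjOn x S := by
    intro i hi j hj hij
    obtain ⟨w, hw⟩ := key {i} (by simpa using hi)
    have h1 := hw i hi
    have h2 := hw j hj
    rw [hij, h2] at h1
    simpa [eq_comm] using h1
  rw [← Finset.card_image_of_injOn hinj]
  refine hd _ fun g => ?_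
  obtain ⟨w, hw⟩ := key (S.filter fun i => g (x i) = true) (Finset.filter_subset _ _)
  refine ⟨w, fun z hz => ?_⟩
  obtain ⟨i, hi, rfl⟩ := Finset.mem_image.1 hz
  rw [hw i hi]
  simp [show i ∈ S from hi]

/-- As `d / n ≤ 1`, the factor `(d / n) ^ d` is at most `(d / n) ^ k` in the `k`-th term; completing
the binomial sum gives `(1 + d / n) ^ n ≤ e ^ d`. -/
lemma sum_choose_mul_pow_le_one {d n : ℕ} (h : d ≤ n) :
    ((∑ k ∈ Finset.Iic d, n.choose k : ℕ) : ℝ) * ((d : ℝ) / (Real.exp 1 * n)) ^ d ≤ 1 := by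
  -- For `d = 0` the power is `0 ^ 0 = 1`; this also covers `n = 0`.
  rcases Nat.eq_zero_or_pos d with rfl | hd
  · have : (Finset.Iic 0 : Finset ℕ) = {0} := rfl
    simp [this]
  have hn : (0 : ℝ) < n := by exact_mod_cast hd.trans_le h
  have hq0 : (0 : ℝ) ≤ d / n := by positivity
  have hq1 : (d : ℝ) / n ≤ 1 := (div_le_one hn).2 (by exact_mod_cast h)
  have h1 : ((∑ k ∈ Finset.Iic d, n.choose k : ℕ) : ℝ) * ((d : ℝ) / n) ^ d ≤ Real.exp 1 ^ d := by
    calc ((∑ k ∈ Finset.Iic d, n.choose k : ℕ) : ℝ) * ((d : ℝ) / n) ^ d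
        = ∑ k ∈ Finset.Iic d, (n.choose k : ℝ) * ((d : ℝ) / n) ^ d := by
          rw [Nat.cast_sum, Finset.sum_mul]
      _ ≤ ∑ k ∈ Finset.Iic d, (n.choose k : ℝ) * ((d : ℝ) / n) ^ k := by
          refine Finset.sum_le_sum fun k hk => ?_
          gcongr ?_ * ?_
          exact pow_le_pow_of_le_one hq0 hq1 (Finset.mem_Iic.1 hk)
      _ ≤ ∑ k ∈ Finset.range (n + 1), (n.choose k : ℝ) * ((d : ℝ) / n) ^ k := by
          refine Finset.sum_le_sum_of_subset_of_nonneg (fun k hk => ?_) fun k _ _ => by positivity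
          have := Finset.mem_Iic.1 hk
          exact Finset.mem_range.2 (by omega)
      _ = ((d : ℝ) / n + 1) ^ n := by
          rw [add_pow]
          exact Finset.sum_congr rfl fun k _ => by rw [one_pow]; ring
      _ ≤ Real.exp (d / n) ^ n := by
          gcongr
          exact Real.add_one_le_exp _
      _ = Real.exp 1 ^ d := by
          rw [← Real.exp_nat_mul, ← Real.exp_nat_mul]
          congr 1
          field_simp
  have h2 : ((d : ℝ) / (Real.exp 1 * n)) ^ d = ((d : ℝ) / n) ^ d / Real.exp 1 ^ d := by
    rw [← div_pow]
    congr 1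
    rw [div_div, mul_comm]
  rw [h2, ← mul_div_assoc]
  exact div_le_one_of_le₀ h1 (by positivity)

/-! ### Realizable families and pointwise sensitivity. -/

namespace ModelFamily

variable {𝒳 : Type*} [MeasurableSpace 𝒳] {dw : ℕ} (M : ModelFamily 𝒳 dw)

lemma measurable_labelProb (y : Bool) :
    Measurable fun p : M.params × 𝒳 => M.labelProb y p.2 p.1 :=
  (M.labelKernel.measurable_coe (measurableSet_singleton y)).ennreal_toReal

lemma measurable_uncurry_classify : Measurable (Function.uncurry M.classify) := by
  refine measurable_to_bool ?_
  have : Function.uncurry M.classify ⁻¹' {true} =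
      {p | M.labelProb false p.2 p.1 < M.labelProb true p.2 p.1} := by
    ext p; simp [Function.uncurry, classify]
  rw [this]
  exact measurableSet_lt (M.measurable_labelProb false) (M.measurable_labelProb true)

lemma measurable_classify (w : M.params) : Measurable (M.classify w) :=
  M.measurable_uncurry_classify.of_uncurry_left

lemma measurableSet_classify_ne :
    MeasurableSet {p : (M.params × M.params) × 𝒳 | M.classify p.1.1 p.2 ≠ M.classify p.1.2 p.2} :=
  (measurableSet_eq_fun
    (M.measurable_uncurry_classify.comp
      ((measurable_fst.comp measurable_fst).prodMk measurable_snd))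
    (M.measurable_uncurry_classify.comp
      ((measurable_snd.comp measurable_fst).prodMk measurable_snd))).compl

lemma measurableSet_discrepancySet (w v : M.params) : MeasurableSet (M.discrepancySet w v) :=
  (measurableSet_eq_fun (M.measurable_classify w) (M.measurable_classify v)).compl

lemma measurable_inputLaw_discrepancySet :
    Measurable fun p : M.params × M.params => M.inputLaw (M.discrepancySet p.1 p.2) :=
  measurable_measure_prodMk_left M.measurableSet_classify_ne

lemma measurable_inputLaw_discrepancySet_right (w : M.params) :
    Measurable fun v : M.params => M.inputLaw (M.discrepancySet w v) :=
  measurable_measure_prodMk_left (s := {p : M.params × 𝒳 | M.classify w p.2 ≠ M.classify p.1 p.2})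
    (measurableSet_eq_fun ((M.measurable_classify w).comp measurable_snd)
      M.measurable_uncurry_classify).compl

lemma measurable_inputLaw_real_discrepancySet :
    Measurable fun p : M.params × M.params => M.inputLaw.real (M.discrepancySet p.1 p.2) :=
  M.measurable_inputLaw_discrepancySet.ennreal_toReal

lemma discrepancySet_comm (w v : M.params) : M.discrepancySet w v = M.discrepancySet v w := by
  ext x; exact ne_comm

lemma discrepancySet_subset_union (u v w : M.params) :
    M.discrepancySet u w ⊆ M.discrepancySet u v ∪ M.discrepancySet v w := by
  intro x hx
  by_contra h
  simp only [discrepancySet, Set.mem_union, Set.mem_ofPred_eq, not_or, not_not] at h hx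
  exact hx (h.1.trans h.2)

variable {M}

/-- Two probabilities in `{0, 1}` with sum one cannot tie, so the argmax is the sure label. -/
lemma Realizable.labelKernel_eq_dirac (h : M.Realizable) (w : M.params) (x : 𝒳) :
    M.labelKernel (w, x) = Measure.dirac (M.classify w x) := by
  have hsum : M.labelProb false x w + M.labelProb true x w = 1 := by
    have h1 := prob_add_prob_compl (μ := M.labelKernel (w, x)) (measurableSet_singleton false)
    have h2 : ({false} : Set Bool)ᶜ = {true} := by ext b; cases b <;> simp
    rw [h2] at h1
    rw [labelProb, labelProb, measureReal_def, measureReal_def,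
      ← ENNReal.toReal_add (measure_ne_top _ _) (measure_ne_top _ _), h1, ENNReal.toReal_one]
  have hprob : ∀ b, M.labelProb b x w = if M.classify w x = b then 1 else 0 := by
    rcases h true x w with h1 | h1
    · have h0 : M.labelProb false x w = 1 := by linarith
      have hc : M.classify w x = false := by simp [classify, h0, h1]
      intro b; cases b <;> simp [h0, h1, hc]
    · have h0 : M.labelProb false x w = 0 := by linarith
      have hc : M.classify w x = true := by simp [classify, h0, h1]
      intro b; cases b <;> simp [h0, h1, hc]
  refine Measure.ext_of_singleton fun b => ?_
  rw [← ENNReal.ofReal_toReal (measure_ne_top (M.labelKernel (w, x)) {b})]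
  change ENNReal.ofReal (M.labelProb b x w) = _
  rw [hprob, Measure.dirac_apply' _ (measurableSet_singleton b)]
  by_cases hb : M.classify w x = b <;> simp [hb]

lemma Realizable.sampleKernel_eq_map (h : M.Realizable) (w : M.params) :
    M.sampleKernel w = M.inputLaw.map fun x => (x, M.classify w x) := by
  have hm : Measurable fun x => (x, M.classify w x) :=
    measurable_id.prodMk (M.measurable_classify w)
  ext s hs
  rw [sampleKernel, Kernel.compProd_apply hs, Measure.map_apply hm hs, Kernel.const_apply,
    ← lintegral_indicator_one (hm hs)]
  refine lintegral_congr fun x => ?_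
  rw [h.labelKernel_eq_dirac, Measure.dirac_apply' _ (measurable_prodMk_left hs)]
  rfl

lemma Realizable.trainKernel_eq_map (h : M.Realizable) (n : ℕ) (w : M.params) :
    M.trainKernel n w = (Measure.pi fun _ : Fin n => M.inputLaw).map
      fun x i => (x i, M.classify w (x i)) := by
  have hm : Measurable fun x => (x, M.classify w x) :=
    measurable_id.prodMk (M.measurable_classify w)
  change (Measure.pi fun _ : Fin n => M.sampleKernel w) = _
  rw [h.sampleKernel_eq_map]
  have : IsProbabilityMeasure (M.inputLaw.map fun x => (x, M.classify w x)) :=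
    Measure.isProbabilityMeasure_map hm.aemeasurable
  rw [Measure.pi_map_pi fun _ => hm.aemeasurable]

/-- The true parameter almost surely has loss zero, so the loss of `v` just records disagreement
with `w`. -/
lemma Realizable.excessLoss_eq (h : M.Realizable) (w v : M.params) :
    M.excessLoss w v = M.inputLaw.real (M.discrepancySet w v) := by
  have hm : Measurable fun x => (x, M.classify w x) :=
    measurable_id.prodMk (M.measurable_classify w)
  have hloss : ∀ u, Measurable fun z : 𝒳 × Bool => M.zeroOneLoss z u := fun u =>
    Measurable.ite (measurableSet_eq_fun ((M.measurable_classify u).comp measurable_fst)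
      measurable_snd).compl measurable_const measurable_const
  rw [excessLoss, h.sampleKernel_eq_map,
    integral_map hm.aemeasurable (show Measurable fun z => M.zeroOneLoss z v - M.zeroOneLoss z w from
      (hloss v).sub (hloss w)).aestronglyMeasurable,
    ← integral_indicator_one (M.measurableSet_discrepancySet w v)]
  refine integral_congr_ae (ae_of_all _ fun x => ?_)
  by_cases hx : M.classify w x = M.classify v x
  · simp [zeroOneLoss, discrepancySet, hx]
  · have hx' : M.classify v x ≠ M.classify w x := fun h => hx h.symm
    simp [zeroOneLoss, discrepancySet, hx, hx']

/-- A conditional law with a density against the prior inherits absolute continuity from it, so it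
is an admissible test of sensitivity. -/
lemma SensitiveInExpectation.lintegral_density_le {μ : ℝ} (h : M.SensitiveInExpectation μ)
    (hac : M.paramLaw ≪ volume) {k : M.params → M.params → ℝ≥0∞}
    (hk : Measurable (Function.uncurry k)) (hk1 : ∀ w, ∫⁻ v, k w v ∂M.prior = 1) :
    ∫⁻ w, ∫⁻ v, k w v * ENNReal.ofReal (μ * ‖(w : Fin dw → ℝ) - (v : Fin dw → ℝ)‖)
        ∂M.prior ∂M.prior
      ≤ ∫⁻ w, ∫⁻ v, k w v * M.inputLaw (M.discrepancySet w v) ∂M.prior ∂M.prior := by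
  have hN : Measurable fun p : M.params × M.params =>
      ENNReal.ofReal ‖(p.1 : Fin dw → ℝ) - (p.2 : Fin dw → ℝ)‖ := by fun_prop
  have hN' : ∀ w : M.params, Measurable fun v : M.params =>
      ENNReal.ofReal ‖(w : Fin dw → ℝ) - (v : Fin dw → ℝ)‖ := fun w => by
    fun_prop
  have hD : ∀ w : M.params, Measurable fun v : M.params => M.inputLaw (M.discrepancySet w v) :=
    fun w => M.measurable_inputLaw_discrepancySet_right w
  have hκ : IsMarkovKernel (Kernel.withDensity (Kernel.const M.params M.prior) k) := by
    refine ⟨fun w => ⟨?_⟩⟩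
    rw [Kernel.withDensity_apply _ hk, withDensity_apply _ .univ, Kernel.const_apply,
      setLIntegral_univ, hk1]
  have hκac : ∀ w, ((Kernel.withDensity (Kernel.const M.params M.prior) k) w).map
      (Subtype.val : M.params → Fin dw → ℝ) ≪ volume := fun w =>
    ((Kernel.withDensity_absolutelyContinuous (κ := Kernel.const M.params M.prior) k w).map
      measurable_subtype_coe).trans hac
  have key := h.2 _ hκ hκac
  have hw : ∀ w (u : M.params → ℝ≥0∞), Measurable u →
      ∫⁻ v, u v ∂(Kernel.withDensity (Kernel.const M.params M.prior) k) w =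
        ∫⁻ v, k w v * u v ∂M.prior := fun w u hu => by
    rw [Kernel.lintegral_withDensity _ hk _ hu, Kernel.const_apply]
  simp only [fun w => hw w _ (hN' w), fun w => hw w _ (hD w)] at key
  refine le_trans (le_of_eq ?_) key
  have hkN : Measurable fun p : M.params × M.params =>
      k p.1 p.2 * ENNReal.ofReal ‖(p.1 : Fin dw → ℝ) - (p.2 : Fin dw → ℝ)‖ := hk.mul hN
  rw [← lintegral_const_mul _ (show Measurable fun w => ∫⁻ v : M.params, k w v *
    ENNReal.ofReal ‖(w : Fin dw → ℝ) - (v : Fin dw → ℝ)‖ ∂M.prior from hkN.lintegral_prod_right')]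
  refine lintegral_congr fun w => ?_
  rw [← lintegral_const_mul _ (show Measurable fun v => k w v *
    ENNReal.ofReal ‖(w : Fin dw → ℝ) - (v : Fin dw → ℝ)‖ from hk.of_uncurry_left.mul (hN' w))]
  refine lintegral_congr fun v => ?_
  rw [ENNReal.ofReal_mul h.1.le]
  ring

/-- Sensitivity in expectation is inherited by almost all pairs of parameters. -/
lemma SensitiveInExpectation.ae_ae_le {μ : ℝ} (h : M.SensitiveInExpectation μ)
    (hac : M.paramLaw ≪ volume) :
    ∀ᵐ w : M.params ∂M.prior, ∀ᵐ v : M.params ∂M.prior,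
      μ * ‖(w : Fin dw → ℝ) - (v : Fin dw → ℝ)‖ ≤ M.inputLaw.real (M.discrepancySet w v) := by
  have key : ∀ᵐ w : M.params ∂M.prior, ∀ᵐ v : M.params ∂M.prior,
      ENNReal.ofReal (μ * ‖(w : Fin dw → ℝ) - (v : Fin dw → ℝ)‖)
        ≤ M.inputLaw (M.discrepancySet w v) := by
    refine ae_ae_le_of_lintegral_density_le M.prior
      (d := fun w v => M.inputLaw (M.discrepancySet w v)) M.measurable_inputLaw_discrepancySet
      (by unfold Function.uncurry; fun_prop) (fun _ _ => prob_le_one)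
      (fun k hk hk1 => h.lintegral_density_le hac hk hk1) fun ε hε => ?_
    -- A cell collects parameters whose positive regions are approximated by the same set `F k`; the
    -- triangle inequality through `F k` makes `d` small within it.
    obtain ⟨g, hg, F, hF, hm, hle⟩ := exists_countable_section_approx M.prior M.inputLaw
      (M.measurable_uncurry_classify (measurableSet_singleton true)) hε
    refine ⟨g, hg, _, hm, hle, fun w v hwv => (measure_mono ?_).trans (measure_union_le _ _)⟩
    intro x hx
    simp only [discrepancySet, Set.mem_ofPred_eq] at hx
    simp only [Set.mem_union, Set.mem_symmDiff, Set.mem_preimage, Function.uncurry,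
      Set.mem_singleton_iff, hwv]
    by_cases hxF : x ∈ F (g v) <;> cases h1 : M.classify w x <;> cases h2 : M.classify v x <;>
      simp_all
  filter_upwards [key] with w hw
  filter_upwards [hw] with v hv
  exact (ENNReal.ofReal_le_iff_le_toReal (measure_ne_top _ _)).1 hv

/-- For every parameter `v`, almost all parameters `w` satisfy the sensitivity bound with `v`
replaced by a suitable point of `ℝ^dw`. -/
lemma SensitiveInExpectation.exists_center {μ : ℝ} (h : M.SensitiveInExpectation μ)
    (hac : M.paramLaw ≪ volume) (v : M.params) :
    ∃ c : Fin dw → ℝ, ∀ᵐ w : M.params ∂M.prior,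
      μ * ‖(w : Fin dw → ℝ) - c‖ ≤ M.inputLaw.real (M.discrepancySet w v) := by
  have hμ := h.1
  obtain ⟨c, hc⟩ := exists_ae_abs_sub_le_of_ae_ae_abs_sub_le M.prior
    (x := fun w => (w : Fin dw → ℝ))
    (r := fun w => M.inputLaw.real (M.discrepancySet w v) / μ) (R := 1 / μ)
    (fun w => by gcongr; exact measureReal_le_one) (by
      filter_upwards [h.ae_ae_le hac] with w hw
      filter_upwards [hw] with w' hw' i
      rw [← add_div, le_div_iff₀ hμ, mul_comm]
      calc μ * |(w : Fin dw → ℝ) i - (w' : Fin dw → ℝ) i|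
          ≤ μ * ‖(w : Fin dw → ℝ) - (w' : Fin dw → ℝ)‖ := by
            gcongr
            exact norm_le_pi_norm ((w : Fin dw → ℝ) - (w' : Fin dw → ℝ)) i
        _ ≤ M.inputLaw.real (M.discrepancySet w w') := hw'
        _ ≤ M.inputLaw.real (M.discrepancySet w v) + M.inputLaw.real (M.discrepancySet v w') :=
            (measureReal_mono (M.discrepancySet_subset_union w v w')).trans
              (measureReal_union_le _ _)
        _ = _ := by rw [M.discrepancySet_comm v w'])
  refine ⟨c, ?_⟩
  filter_upwards [hc] with w hw
  rw [mul_comm, ← le_div_iff₀ hμ]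
  exact (pi_norm_le_iff_of_nonneg (by positivity)).2 hw

end ModelFamily

/-! ### Jensen's inequality and differential entropy. -/

/-- Jensen's inequality for the exponential function. -/
lemma ofReal_exp_integral_le_lintegral {Ω : Type*} [MeasurableSpace Ω] {J : Measure Ω}
    [IsProbabilityMeasure J] {g : Ω → ℝ} (hg : Integrable g J) :
    ENNReal.ofReal (Real.exp (∫ ω, g ω ∂J)) ≤ ∫⁻ ω, ENNReal.ofReal (Real.exp (g ω)) ∂J := by
  by_cases htop : ∫⁻ ω, ENNReal.ofReal (Real.exp (g ω)) ∂J = ∞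
  · rw [htop]; exact le_top
  have hint : Integrable (fun ω => Real.exp (g ω)) J :=
    (lintegral_ofReal_ne_top_iff_integrable (Real.continuous_exp.comp_aestronglyMeasurable hg.1)
      (ae_of_all _ fun ω => (Real.exp_pos _).le)).1 htop
  rw [← ofReal_integral_eq_lintegral_ofReal hint (ae_of_all _ fun ω => (Real.exp_pos _).le)]
  exact ENNReal.ofReal_le_ofReal (convexOn_exp.map_integral_le Real.continuous_exp.continuousOn
    isClosed_univ (by simp) hg hint)

section Density

variable {k : ℕ} (ν : Measure (Fin k → ℝ))

lemma measurable_lebesgueDensity : Measurable (lebesgueDensity ν) :=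
  (Measure.measurable_rnDeriv _ _).ennreal_toReal

variable {ν}

/-- The weight `1/p` cancels the density where `p > 0`. Where `p = 0` the convention `log 0 = 0`
makes the weight one, but the density kills it; hence only an inequality. -/
lemma lintegral_exp_neg_log_lebesgueDensity_mul_le [IsFiniteMeasure ν] (hν : ν ≪ volume)
    {f : (Fin k → ℝ) → ℝ≥0∞} (hf : Measurable f) :
    ∫⁻ x, ENNReal.ofReal (Real.exp (-Real.log (lebesgueDensity ν x))) * f x ∂ν ≤ ∫⁻ x, f x := by
  have hm : Measurable fun x =>
      ENNReal.ofReal (Real.exp (-Real.log (lebesgueDensity ν x))) * f x :=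
    (measurable_lebesgueDensity ν).log.neg.exp.ennreal_ofReal.mul hf
  rw [← lintegral_rnDeriv_mul hν hm.aemeasurable]
  refine lintegral_mono_ae ?_
  filter_upwards [Measure.rnDeriv_lt_top ν volume] with x hx
  rw [← mul_assoc]
  refine mul_le_of_le_one_left' ?_
  rw [← ENNReal.ofReal_toReal hx.ne]
  change ENNReal.ofReal (lebesgueDensity ν x) * _ ≤ 1
  have hnonneg : 0 ≤ lebesgueDensity ν x := ENNReal.toReal_nonneg
  rcases hnonneg.eq_or_lt with h0 | hpos
  · rw [← h0]; simp
  · rw [← ENNReal.ofReal_mul hpos.le, Real.exp_neg, Real.exp_log hpos, mul_inv_cancel₀ hpos.ne']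
    simp

lemma HasDiffEntropy.integrable_neg_log [IsFiniteMeasure ν] (h : HasDiffEntropy ν) :
    Integrable (fun x => -Real.log (lebesgueDensity ν x)) ν := by
  rw [← integrable_rnDeriv_smul_iff h.1]
  refine h.2.congr (ae_of_all _ fun x => ?_)
  simp [Real.negMulLog, lebesgueDensity]

lemma HasDiffEntropy.integral_neg_log [IsFiniteMeasure ν] (h : HasDiffEntropy ν) :
    ∫ x, -Real.log (lebesgueDensity ν x) ∂ν = diffEntropy ν := by
  rw [← integral_rnDeriv_smul h.1]
  refine integral_congr_ae (ae_of_all _ fun x => ?_)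
  simp [Real.negMulLog, lebesgueDensity]

end Density

/-! ### The entropy–risk trade-off. -/

namespace ModelFamily

variable {𝒳 : Type*} [MeasurableSpace 𝒳] {dw : ℕ} {M : ModelFamily 𝒳 dw}

instance : IsProbabilityMeasure M.paramLaw :=
  Measure.isProbabilityMeasure_map measurable_subtype_coe.aemeasurable

instance (n : ℕ) : IsMarkovKernel (M.trainKernel n) :=
  ⟨fun w => inferInstanceAs (IsProbabilityMeasure (Measure.pi fun _ : Fin n => M.sampleKernel w))⟩

/-- The law of a learned parameter involves at most `∑ k ≤ d, n.choose k` different labellings of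
each sample of inputs. -/
lemma Realizable.lintegral_comp_trainKernel_le (h : M.Realizable) {d n : ℕ} (hvc : M.HasVCDim d)
    (Q : Kernel (Fin n → 𝒳 × Bool) M.params) [IsMarkovKernel Q]
    {u : M.params → M.params → ℝ≥0∞} (hu : Measurable (Function.uncurry u)) {L : ℝ≥0∞}
    (hL : ∀ v, ∫⁻ w, u w v ∂M.prior ≤ L) :
    ∫⁻ w, ∫⁻ v, u w v ∂(Q ∘ₖ M.trainKernel n) w ∂M.prior
      ≤ (∑ k ∈ Finset.Iic d, n.choose k : ℕ) * L := by
  classical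
  set Φ : M.params → (Fin n → 𝒳) → (Fin n → 𝒳 × Bool) :=
    fun w x i => (x i, M.classify w (x i)) with hΦ
  have hΦm : Measurable (Function.uncurry Φ) := by
    refine measurable_pi_lambda _ fun i => ?_
    have hi : Measurable fun p : M.params × (Fin n → 𝒳) => p.2 i :=
      (measurable_pi_apply i).comp measurable_snd
    exact hi.prodMk (M.measurable_uncurry_classify.comp (measurable_fst.prodMk hi))
  set H : M.params → (Fin n → 𝒳 × Bool) → ℝ≥0∞ := fun w z => ∫⁻ v, u w v ∂Q z with hH
  have hHm : Measurable (Function.uncurry H) := by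
    have : Measurable fun p : (M.params × (Fin n → 𝒳 × Bool)) × M.params => u p.1.1 p.2 :=
      hu.comp ((measurable_fst.comp measurable_fst).prodMk measurable_snd)
    exact this.lintegral_kernel_prod_right' (κ := Q.comap Prod.snd measurable_snd)
  have hHΦm : Measurable fun p : M.params × (Fin n → 𝒳) => H p.1 (Φ p.1 p.2) :=
    hHm.comp (measurable_fst.prodMk hΦm)
  calc ∫⁻ w, ∫⁻ v, u w v ∂(Q ∘ₖ M.trainKernel n) w ∂M.prior
      = ∫⁻ w, ∫⁻ x, H w (Φ w x) ∂(Measure.pi fun _ : Fin n => M.inputLaw) ∂M.prior := by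
        refine lintegral_congr fun w => ?_
        rw [Kernel.lintegral_comp _ _ _ hu.of_uncurry_left, h.trainKernel_eq_map,
          lintegral_map hHm.of_uncurry_left hΦm.of_uncurry_left]
    _ = ∫⁻ x, ∫⁻ w, H w (Φ w x) ∂M.prior ∂(Measure.pi fun _ : Fin n => M.inputLaw) :=
        lintegral_lintegral_swap hHΦm.aemeasurable
    _ ≤ ∫⁻ _x, (∑ k ∈ Finset.Iic d, n.choose k : ℕ) * L
          ∂(Measure.pi fun _ : Fin n => M.inputLaw) := by
        refine lintegral_mono fun x => ?_
        set T : Finset (Fin n → Bool) :=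
          Finset.univ.filter fun y => ∃ w, ∀ i, M.classify w (x i) = y i with hT
        have hcard : T.card ≤ ∑ k ∈ Finset.Iic d, n.choose k :=
          card_le_sum_choose_of_shattered_card_le (fun S hS => hvc.2 ⟨S, rfl, hS⟩) x T
            fun y hy => (Finset.mem_filter.1 hy).2
        -- The actual labelling depends on `w`. Bounding by the sum over `T` removes this
        -- dependence: each term has a fixed training set, so integrating over `w` first for each
        -- output `v` brings in `hL`.
        calc ∫⁻ w, H w (Φ w x) ∂M.prior
            ≤ ∫⁻ w, ∑ y ∈ T, H w (fun i => (x i, y i)) ∂M.prior := by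
              refine lintegral_mono fun w => ?_
              exact Finset.single_le_sum (f := fun y : Fin n → Bool => H w fun i => (x i, y i))
                (fun _ _ => zero_le) (Finset.mem_filter.2
                  ⟨Finset.mem_univ fun i => M.classify w (x i), w, fun _ => rfl⟩)
          _ = ∑ y ∈ T, ∫⁻ w, H w (fun i => (x i, y i)) ∂M.prior :=
              lintegral_finsetSum _ fun y _ => hHm.of_uncurry_right
          _ ≤ ∑ _y ∈ T, L := by
              refine Finset.sum_le_sum fun y _ => ?_
              simp only [hH]
              rw [lintegral_lintegral_swap hu.aemeasurable]
              refine (lintegral_mono hL).trans ?_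
              simp
          _ ≤ (∑ k ∈ Finset.Iic d, n.choose k : ℕ) * L := by
              rw [Finset.sum_const, nsmul_eq_mul]
              gcongr
    _ = (∑ k ∈ Finset.Iic d, n.choose k : ℕ) * L := by simp

lemma Realizable.excessBayesRisk_eq (h : M.Realizable) {n : ℕ}
    (Q : Kernel (Fin n → 𝒳 × Bool) M.params) [IsMarkovKernel Q] :
    M.excessBayesRisk Q = ∫ p, M.inputLaw.real (M.discrepancySet p.1 p.2)
      ∂(M.prior ⊗ₘ (Q ∘ₖ M.trainKernel n)) := by
  have hb : ∀ w v, ‖M.inputLaw.real (M.discrepancySet w v)‖ ≤ 1 := fun w v => by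
    rw [Real.norm_of_nonneg measureReal_nonneg]; exact measureReal_le_one
  have hm : ∀ w, Measurable fun v => M.inputLaw.real (M.discrepancySet w v) := fun w =>
    (M.measurable_inputLaw_discrepancySet_right w).ennreal_toReal
  rw [Measure.integral_compProd (Integrable.of_bound
    M.measurable_inputLaw_real_discrepancySet.aestronglyMeasurable 1 (ae_of_all _ fun p => hb _ _))]
  refine integral_congr_ae (ae_of_all _ fun w => ?_)
  dsimp only
  rw [Kernel.integral_comp (Integrable.of_bound (hm w).aestronglyMeasurable 1
    (ae_of_all _ fun v => hb _ _))]
  simp only [h.excessLoss_eq]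

/-- The trade-off between the differential entropy of the parameter, the growth function of the
class and the excess Bayes risk, with a free scale `s`. -/
lemma exp_diffEntropy_sub_le (hdw : 0 < dw) (hreal : M.Realizable) {d : ℕ} (hvc : M.HasVCDim d)
    {μ : ℝ} (hsens : M.SensitiveInExpectation μ) (hent : HasDiffEntropy M.paramLaw) {n : ℕ}
    (Q : Kernel (Fin n → 𝒳 × Bool) M.params) [IsMarkovKernel Q] {s : ℝ} (hs : 0 < s) :
    Real.exp (diffEntropy M.paramLaw - M.excessBayesRisk Q / (μ * s))
      ≤ (∑ k ∈ Finset.Iic d, n.choose k : ℕ) * (2 * (dw * s)) ^ dw := by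
  have hμ := hsens.1
  set p : M.params → ℝ := fun w => -Real.log (lebesgueDensity M.paramLaw (w : Fin dw → ℝ)) with hp
  set D : M.params → M.params → ℝ := fun w v => M.inputLaw.real (M.discrepancySet w v) with hD
  set J : Measure (M.params × M.params) := M.prior ⊗ₘ (Q ∘ₖ M.trainKernel n) with hJ
  have hpm : Measurable p := (measurable_lebesgueDensity _).log.neg.comp measurable_subtype_coe
  have hDm : Measurable (Function.uncurry D) := M.measurable_inputLaw_real_discrepancySet
  have hpint : Integrable p M.prior :=
    hent.integrable_neg_log.comp_measurable measurable_subtype_coe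
  have hpJ : Integrable (fun q : M.params × M.params => p q.1) J := by
    refine (Measure.integrable_compProd_iff (hpm.comp measurable_fst).aestronglyMeasurable).2
      ⟨ae_of_all _ fun w => integrable_const (p w), ?_⟩
    simpa using hpint.norm
  have hDJ : Integrable (fun q : M.params × M.params => D q.1 q.2) J :=
    Integrable.of_bound hDm.aestronglyMeasurable 1 (ae_of_all _ fun q => by
      rw [Real.norm_of_nonneg measureReal_nonneg]; exact measureReal_le_one)
  have hpJint : ∫ q, p q.1 ∂J = diffEntropy M.paramLaw := by
    have h1 : ∫ x, -Real.log (lebesgueDensity M.paramLaw x) ∂M.paramLaw = ∫ w, p w ∂M.prior :=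
      integral_map measurable_subtype_coe.aemeasurable
        (measurable_lebesgueDensity _).log.neg.aestronglyMeasurable
    rw [← hent.integral_neg_log, h1, hJ, Measure.integral_compProd hpJ]
    simp
  have hgint : ∫ q, (p q.1 - D q.1 q.2 / (μ * s)) ∂J =
      diffEntropy M.paramLaw - M.excessBayesRisk Q / (μ * s) := by
    rw [integral_sub hpJ (hDJ.div_const _), hpJint, integral_div, hreal.excessBayesRisk_eq Q]
  set u : M.params → M.params → ℝ≥0∞ := fun w v =>
    ENNReal.ofReal (Real.exp (p w)) * ENNReal.ofReal (Real.exp (-D w v / (μ * s))) with hu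
  have hum : Measurable (Function.uncurry u) :=
    (hpm.comp measurable_fst).exp.ennreal_ofReal.mul
      ((hDm.neg.div_const (μ * s)).exp.ennreal_ofReal)
  have hL : ∀ v, ∫⁻ w, u w v ∂M.prior ≤ ENNReal.ofReal ((2 * (dw * s)) ^ dw) := by
    intro v
    obtain ⟨c, hc⟩ := hsens.exists_center hent.1 v
    have hfm : Measurable fun x : Fin dw → ℝ => ENNReal.ofReal (Real.exp (-‖x - c‖ / s)) := by
      fun_prop
    refine le_trans ?_ ((lintegral_exp_neg_log_lebesgueDensity_mul_le hent.1 hfm).trans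
      (lintegral_exp_neg_norm_sub_le hdw hs c))
    refine le_trans (lintegral_mono_ae ?_) (lintegral_map
      ((measurable_lebesgueDensity _).log.neg.exp.ennreal_ofReal.mul hfm)
      measurable_subtype_coe).ge
    filter_upwards [hc] with w hw
    refine mul_le_mul_right (ENNReal.ofReal_le_ofReal (Real.exp_le_exp.2 ?_)) _
    rw [neg_div, neg_div, neg_le_neg_iff, div_le_div_iff₀ hs (by positivity)]
    calc ‖(w : Fin dw → ℝ) - c‖ * (μ * s) = μ * ‖(w : Fin dw → ℝ) - c‖ * s := by ring
      _ ≤ D w v * s := by gcongr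
  have key : ENNReal.ofReal (Real.exp (diffEntropy M.paramLaw - M.excessBayesRisk Q / (μ * s)))
      ≤ (∑ k ∈ Finset.Iic d, n.choose k : ℕ) * ENNReal.ofReal ((2 * (dw * s)) ^ dw) := by
    rw [← hgint]
    refine (ofReal_exp_integral_le_lintegral (hpJ.sub (hDJ.div_const _))).trans ?_
    refine le_trans (le_of_eq ?_) (hreal.lintegral_comp_trainKernel_le hvc Q hum hL)
    refine Eq.trans (lintegral_congr fun q => ?_) (Measure.lintegral_compProd hum)
    simp only [hu, Function.uncurry, Pi.sub_apply]
    rw [← ENNReal.ofReal_mul (Real.exp_pos _).le, ← Real.exp_add, neg_div, sub_eq_add_neg]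
  rwa [← ENNReal.ofReal_natCast, ← ENNReal.ofReal_mul (Nat.cast_nonneg _),
    ENNReal.ofReal_le_ofReal_iff (by positivity)] at key

lemma rpow_mul_exp_diffEntropy_le_excessBayesRisk (hdw : 0 < dw) (hreal : M.Realizable) {d : ℕ}
    (hvc : M.HasVCDim d) {μ : ℝ} (hsens : M.SensitiveInExpectation μ)
    (hent : HasDiffEntropy M.paramLaw) {n : ℕ} (hn : d ≤ n)
    (Q : Kernel (Fin n → 𝒳 × Bool) M.params) [IsMarkovKernel Q] :
    ((d : ℝ) / (Real.exp 1 * n)) ^ ((d : ℝ) / (dw : ℝ)) * (μ / (2 * Real.exp 1)) *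
        Real.exp (diffEntropy M.paramLaw / dw) ≤ M.excessBayesRisk Q := by
  have hμ := hsens.1
  have hdw' : (0 : ℝ) < dw := by exact_mod_cast hdw
  have hE : 0 ≤ M.excessBayesRisk Q := by
    rw [hreal.excessBayesRisk_eq Q]
    exact integral_nonneg fun _ => measureReal_nonneg
  -- The scale must be positive while the risk is so far only known to be nonnegative, so any `t`
  -- above the risk stands in for it.
  refine le_of_forall_gt_imp_ge_of_dense fun t ht => ?_
  have ht0 : 0 < t := hE.trans_lt ht
  -- The minimizer of `t / (μ s) + d_w log s`; it makes the risk term at most `d_w`, a factor `e`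
  -- per dimension.
  have key := exp_diffEntropy_sub_le hdw hreal hvc hsens hent Q
    (s := t / (μ * dw)) (by positivity)
  set G : ℝ := ((∑ k ∈ Finset.Iic d, n.choose k : ℕ) : ℝ) with hG
  set q : ℝ := (d : ℝ) / (Real.exp 1 * n) with hq
  have hq0 : 0 ≤ q := by positivity
  have hGq : G * q ^ d ≤ 1 := sum_choose_mul_pow_le_one hn
  have hexp : Real.exp (diffEntropy M.paramLaw) ≤ G * (2 * Real.exp 1 * t / μ) ^ dw := by
    have h1 : M.excessBayesRisk Q / (μ * (t / (μ * dw))) ≤ dw := by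
      have h2 : μ * (t / (μ * dw)) = t / dw := by field_simp
      rw [h2, div_div_eq_mul_div, div_le_iff₀ ht0, mul_comm]
      gcongr
    calc Real.exp (diffEntropy M.paramLaw)
        = Real.exp (diffEntropy M.paramLaw - dw) * Real.exp dw := by
          rw [← Real.exp_add, sub_add_cancel]
      _ ≤ G * (2 * (dw * (t / (μ * dw)))) ^ dw * Real.exp 1 ^ dw := by
          rw [← Real.exp_nat_mul, mul_one]
          gcongr
          exact (Real.exp_le_exp.2 (by linarith)).trans key
      _ = G * (2 * Real.exp 1 * t / μ) ^ dw := by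
          rw [mul_assoc, ← mul_pow]
          congr 2
          field_simp
  refine le_of_pow_le_pow_left₀ hdw.ne' ht0.le ?_
  rw [mul_pow, mul_pow, ← Real.rpow_natCast (q ^ _), ← Real.rpow_mul hq0,
    div_mul_cancel₀ _ hdw'.ne', Real.rpow_natCast, ← Real.exp_nat_mul,
    mul_div_cancel₀ _ hdw'.ne']
  calc q ^ d * (μ / (2 * Real.exp 1)) ^ dw * Real.exp (diffEntropy M.paramLaw)
      ≤ q ^ d * (μ / (2 * Real.exp 1)) ^ dw * (G * (2 * Real.exp 1 * t / μ) ^ dw) := by gcongr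
    _ = G * q ^ d * (μ / (2 * Real.exp 1) * (2 * Real.exp 1 * t / μ)) ^ dw := by
        rw [mul_pow]; ring
    _ ≤ 1 * (μ / (2 * Real.exp 1) * (2 * Real.exp 1 * t / μ)) ^ dw := by gcongr
    _ = t ^ dw := by
        rw [one_mul]
        congr 1
        field_simp

end ModelFamily

end

/-! ### The lower bound and its fast-rate case. -/

theorem mainTheorem1 {𝒳 : Type*} [MeasurableSpace 𝒳] {dw : ℕ} (hdw : 0 < dw)
    (M : ModelFamily 𝒳 dw) (hreal : M.Realizable)
    (dvc : ℕ) (hvc : M.HasVCDim dvc)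
    (μ : ℝ) (hsens : M.SensitiveInExpectation μ)
    (hent : HasDiffEntropy M.paramLaw) :
    (∀ n : ℕ, dvc ≤ n →
      ∀ Q : Kernel (Fin n → 𝒳 × Bool) M.params, IsMarkovKernel Q →
        ((dvc : ℝ) / (Real.exp 1 * n)) ^ ((dvc : ℝ) / (dw : ℝ)) * (μ / (2 * Real.exp 1)) *
            Real.exp (diffEntropy M.paramLaw / dw)
          ≤ M.excessBayesRisk Q) ∧
    (dw = dvc →
      (∀ n : ℕ, dvc ≤ n →
        ∀ Q : Kernel (Fin n → 𝒳 × Bool) M.params, IsMarkovKernel Q →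
          μ / (2 * Real.exp 1 ^ 2) * Real.exp (diffEntropy M.paramLaw / dw) * ((dvc : ℝ) / n)
            ≤ M.excessBayesRisk Q) ∧
      (∀ Q : (n : ℕ) → Kernel (Fin n → 𝒳 × Bool) M.params, (∀ n, IsMarkovKernel (Q n)) →
        (fun n : ℕ => (dvc : ℝ) / n) =O[Filter.atTop] fun n => M.excessBayesRisk (Q n))) := by
  have main : ∀ n : ℕ, dvc ≤ n → ∀ Q : Kernel (Fin n → 𝒳 × Bool) M.params, IsMarkovKernel Q →
      ((dvc : ℝ) / (Real.exp 1 * n)) ^ ((dvc : ℝ) / (dw : ℝ)) * (μ / (2 * Real.exp 1)) *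
          Real.exp (diffEntropy M.paramLaw / dw) ≤ M.excessBayesRisk Q := fun n hn Q _ =>
    M.rpow_mul_exp_diffEntropy_le_excessBayesRisk hdw hreal hvc hsens hent hn Q
  refine ⟨main, fun hdd => ?_⟩
  have hμ := hsens.1
  have hfast : ∀ n : ℕ, dvc ≤ n → ∀ Q : Kernel (Fin n → 𝒳 × Bool) M.params, IsMarkovKernel Q →
      μ / (2 * Real.exp 1 ^ 2) * Real.exp (diffEntropy M.paramLaw / dw) * ((dvc : ℝ) / n)
        ≤ M.excessBayesRisk Q := by
    intro n hn Q hQ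
    refine le_trans (le_of_eq ?_) (main n hn Q hQ)
    have hdw' : (dw : ℝ) ≠ 0 := by exact_mod_cast hdw.ne'
    -- Here `n ≥ dvc = dw > 0`.
    have hn' : (n : ℝ) ≠ 0 := by
      have : n ≠ 0 := by omega
      exact_mod_cast this
    rw [← hdd, div_self hdw', Real.rpow_one]
    field_simp
  refine ⟨hfast, fun Q hQ => ?_⟩
  set c : ℝ := μ / (2 * Real.exp 1 ^ 2) * Real.exp (diffEntropy M.paramLaw / dw) with hc
  have hc0 : 0 < c := by positivity
  refine IsBigO.of_bound c⁻¹ ?_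
  filter_upwards [Filter.eventually_ge_atTop dvc] with n hn
  rw [Real.norm_of_nonneg (by positivity), inv_mul_eq_div, le_div_iff₀ hc0, mul_comm]
  exact (hfast n hn (Q n) (hQ n)).trans (le_abs_self _)
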